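/- Let $G$ be a compact topological group whose topology is induced by a bi-invariant metric $d$, let $\nu$ be a Haar measure on $G$ and let $\delta>0$. Assume that $(G,d,\nu)$ is Ahlfors $\delta$-regular: there is a constant $C\ge 1$ such that $$C^{-1}r^{\delta}\le \nu(\overline{B}(x,r))\le C r^{\delta}\qquad\text{for all } x\in G \text{ and } 0\le r<\operatorname{diam} G,$$ where $\overline{B}(x,r)=\{y\in G : d(x,y)\le r\}$. Then for every Lipschitz continuous function $f:G\to\mathbb R$ and every $x \in G$ the integral $$\Delta_0 f(x)=\int_{G\setminus\{x\}} \frac{f(x)-f(y)}{d(x,y)^{\delta}}\,\mathrm{d}\nu(y)$$ converges absolutely, $\Delta_0 f\in L^2(G,\nu)$, and the operator $\Delta_0:\operatorname{Lip}(G,d)\to L^2(G,\nu)$, with domain the real-valued Lipschitz continuous functions, is essentially self-adjoint in the real Hilbert space $L^2(G,\nu)$; that is, it is densely defined and symmetric, and its closure is self-adjoint. -/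

import Mathlib

open MeasureTheory Set Filter Topology
open scoped ENNReal NNReal

noncomputable section

/-- A Borel measure `μ` on a metric space `X` is Ahlfors `δ`-regular, `δ > 0`: there is `C ≥ 1`
with `C⁻¹ r ^ δ ≤ μ (closedBall x r) ≤ C r ^ δ` for all `x` and all `0 ≤ r < diam X`. -/
def IsAhlforsRegular {X : Type*} [MetricSpace X] [MeasurableSpace X] (δ : ℝ) (μ : Measure X) :
    Prop :=
  0 < δ ∧ ∃ C : ℝ, 1 ≤ C ∧ ∀ (x : X) (r : ℝ), 0 ≤ r →
    ENNReal.ofReal r < Metric.ediam (univ : Set X) →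
      ENNReal.ofReal (C⁻¹ * r ^ δ) ≤ μ (Metric.closedBall x r) ∧
        μ (Metric.closedBall x r) ≤ ENNReal.ofReal (C * r ^ δ)

/-- An unbounded operator `T` on a Hilbert space is essentially self-adjoint if it is densely
defined and symmetric and its closure is self-adjoint. -/
def LinearPMap.IsEssentiallySelfAdjoint {H : Type*} [NormedAddCommGroup H]
    [InnerProductSpace ℝ H] [CompleteSpace H] (T : H →ₗ.[ℝ] H) : Prop :=
  Dense (T.domain : Set H) ∧ T.IsFormalAdjoint T ∧ IsSelfAdjoint T.closure

section LogLaplacian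

variable {X : Type*} [MetricSpace X] [MeasurableSpace X]

/-- The function `x ↦ ∫ (f x - f y) / d(x, y) ^ δ dμ(y)`. The integrand is `0` at `y = x`, so the
diagonal does not contribute. -/
def logIntegral (δ : ℝ) (μ : Measure X) (f : X → ℝ) (x : X) : ℝ :=
  ∫ y, (f x - f y) / dist x y ^ δ ∂μ

/-- The classes in `L²(X, μ)` of the real-valued Lipschitz functions on `X`. -/
def lipSubmodule (μ : Measure X) : Submodule ℝ (Lp ℝ 2 μ) where
  carrier := {u | ∃ (f : X → ℝ) (K : ℝ≥0), LipschitzWith K f ∧ u =ᵐ[μ] f}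
  add_mem' := by
    rintro u v ⟨f, K, hf, hu⟩ ⟨g, L, hg, hv⟩
    exact ⟨f + g, K + L, hf.add hg, (Lp.coeFn_add u v).trans (hu.add hv)⟩
  zero_mem' := ⟨0, 0, LipschitzWith.const 0, Lp.coeFn_zero ℝ 2 μ⟩
  smul_mem' := by
    rintro c u ⟨f, K, hf, hu⟩
    exact ⟨c • f, ‖c‖₊ * K, (lipschitzWith_smul c).comp hf,
      (Lp.coeFn_smul c u).trans (hu.const_smul c)⟩

theorem logIntegral_congr_ae {δ : ℝ} {μ : Measure X} {f g : X → ℝ} (h : f =ᵐ[μ] g) :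
    logIntegral δ μ f =ᵐ[μ] logIntegral δ μ g := by
  filter_upwards [h] with x hx
  apply integral_congr_ae
  filter_upwards [h] with y hy
  rw [hx, hy]

variable [BorelSpace X] [CompactSpace X]

/-- The integrals `∫ d(x, y) ^ (1 - δ) dμ(y)`, written so that the integrand vanishes on the
diagonal, are bounded uniformly in `x`. -/
theorem IsAhlforsRegular.exists_lintegral_le {δ : ℝ} {μ : Measure X} [IsFiniteMeasure μ]
    (h : IsAhlforsRegular δ μ) :
    ∃ M : ℝ≥0, ∀ x, ∫⁻ y, ENNReal.ofReal (dist x y / dist x y ^ δ) ∂μ ≤ M := by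
  obtain ⟨hδ, C, hC, hball⟩ := h
  set D := Metric.diam (univ : Set X) with hD
  have hbdd : Bornology.IsBounded (univ : Set X) := isCompact_univ.isBounded
  have hdist : ∀ x y : X, dist x y ≤ D := fun x y =>
    Metric.dist_le_diam_of_mem hbdd (mem_univ x) (mem_univ y)
  rcases (Metric.diam_nonneg (s := (univ : Set X))).eq_or_lt with h0 | h0
  · refine ⟨0, fun x => ?_⟩
    have : ∀ y, dist x y = 0 := fun y => le_antisymm ((hdist x y).trans h0.ge) dist_nonneg
    simp [this]
  change 0 < D at h0
  set C' : ℝ := max C (μ.real univ / D ^ δ) with hC'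
  have hC'0 : 0 ≤ C' := (zero_le_one.trans hC).trans (le_max_left _ _)
  set r : ℕ → ℝ := fun n => D * (1 / 2) ^ n with hr
  have hrpos : ∀ n, 0 < r n := fun n => by positivity
  have hrle : ∀ n, r n ≤ D := fun n =>
    mul_le_of_le_one_right h0.le (pow_le_one₀ (by norm_num) (by norm_num))
  have hmeas : ∀ x n, μ (Metric.closedBall x (r n)) ≤ ENNReal.ofReal (C' * r n ^ δ) := by
    intro x n
    rcases (hrle n).lt_or_eq with hlt | heq
    · refine (hball x (r n) (hrpos n).le ?_).2.trans (ENNReal.ofReal_le_ofReal ?_)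
      · rw [ENNReal.ofReal_lt_iff_lt_toReal (hrpos n).le hbdd.ediam_ne_top]
        exact hlt
      · exact mul_le_mul_of_nonneg_right (le_max_left _ _) (by have := hrpos n; positivity)
    · rw [heq]
      refine (measure_mono (subset_univ _)).trans ?_
      rw [← ofReal_measureReal (measure_ne_top μ univ)]
      refine ENNReal.ofReal_le_ofReal ?_
      have hDδ : 0 < D ^ δ := Real.rpow_pos_of_pos h0 δ
      rw [← div_le_iff₀ hDδ]
      exact le_max_right _ _
  set w : ℕ → ℝ := fun n => r n * 2 ^ δ / r n ^ δ with hw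
  have hw0 : ∀ n, 0 ≤ w n := fun n => by have := hrpos n; positivity
  have hpt : ∀ x y : X, ENNReal.ofReal (dist x y / dist x y ^ δ) ≤
      ∑' n, (Metric.closedBall x (r n)).indicator (fun _ => ENNReal.ofReal (w n)) y := by
    intro x y
    rcases (dist_nonneg (x := x) (y := y)).eq_or_lt with hxy | hxy
    · simp [← hxy]
    obtain ⟨n, hn1, hn2⟩ := exists_nat_pow_near_of_lt_one (x := dist x y / D) (y := (1 / 2 : ℝ))
      (by positivity) ((div_le_one h0).2 (hdist x y)) (by norm_num) (by norm_num)
    rw [lt_div_iff₀ h0] at hn1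
    rw [div_le_iff₀ h0] at hn2
    have h1 : dist x y ≤ r n := by rw [hr]; linarith
    have h2 : r n / 2 ≤ dist x y := by
      have : r n / 2 = (1 / 2) ^ (n + 1) * D := by simp only [hr]; ring
      linarith
    refine le_trans ?_ (ENNReal.le_tsum n)
    rw [indicator_of_mem (by rwa [Metric.mem_closedBall, dist_comm])]
    refine ENNReal.ofReal_le_ofReal ?_
    have h3 : (r n / 2) ^ δ ≤ dist x y ^ δ :=
      Real.rpow_le_rpow (by have := hrpos n; positivity) h2 hδ.le
    have h4 : w n = r n / (r n / 2) ^ δ := by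
      rw [hw, Real.div_rpow (hrpos n).le zero_le_two]
      field_simp
    rw [h4]
    exact div_le_div₀ (hrpos n).le h1 (by have := hrpos n; positivity) h3
  have hsum : Summable fun n => C' * 2 ^ δ * r n :=
    ((summable_geometric_of_lt_one (by norm_num) (by norm_num)).mul_left D).mul_left _
  refine ⟨(∑' n, C' * 2 ^ δ * r n).toNNReal, fun x => ?_⟩
  calc ∫⁻ y, ENNReal.ofReal (dist x y / dist x y ^ δ) ∂μ
      ≤ ∫⁻ y, ∑' n, (Metric.closedBall x (r n)).indicator (fun _ => ENNReal.ofReal (w n)) y ∂μ :=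
        lintegral_mono (hpt x)
    _ = ∑' n, ENNReal.ofReal (w n) * μ (Metric.closedBall x (r n)) := by
        rw [lintegral_tsum fun n =>
          (measurable_const.indicator Metric.isClosed_closedBall.measurableSet).aemeasurable]
        simp only [lintegral_indicator_const Metric.isClosed_closedBall.measurableSet]
    _ ≤ ∑' n, ENNReal.ofReal (C' * 2 ^ δ * r n) := by
        refine ENNReal.tsum_le_tsum fun n => ?_
        refine (mul_le_mul_right (hmeas x n) _).trans ?_
        rw [← ENNReal.ofReal_mul (hw0 n)]
        refine ENNReal.ofReal_le_ofReal (le_of_eq ?_)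
        have : 0 < r n ^ δ := Real.rpow_pos_of_pos (hrpos n) δ
        rw [hw]
        field_simp
    _ = ENNReal.ofReal (∑' n, C' * 2 ^ δ * r n) :=
        (ENNReal.ofReal_tsum_of_nonneg (fun n => by have := hrpos n; positivity) hsum).symm
    _ ≤ _ := le_rfl

/-- For a Lipschitz function the defining integral converges absolutely at every point. -/
theorem IsAhlforsRegular.integrable {δ : ℝ} {μ : Measure X} [IsFiniteMeasure μ]
    (h : IsAhlforsRegular δ μ) {f : X → ℝ} {K : ℝ≥0} (hf : LipschitzWith K f) (x : X) :
    Integrable (fun y => (f x - f y) / dist x y ^ δ) μ := by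
  obtain ⟨M, hM⟩ := h.exists_lintegral_le
  refine ⟨Measurable.aestronglyMeasurable ?_, ?_⟩
  · exact (measurable_const.sub hf.continuous.measurable).div
      ((continuous_const.dist continuous_id).measurable.pow_const δ)
  · refine lt_of_le_of_lt (b := K * ∫⁻ y, ENNReal.ofReal (dist x y / dist x y ^ δ) ∂μ) ?_
      (ENNReal.mul_lt_top ENNReal.coe_lt_top ((hM x).trans_lt ENNReal.coe_lt_top))
    rw [← lintegral_const_mul' _ _ ENNReal.coe_ne_top]
    refine lintegral_mono fun y => ?_
    rw [← ENNReal.ofReal_coe_nnreal, ← ENNReal.ofReal_mul K.coe_nonneg, ← ofReal_norm]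
    refine ENNReal.ofReal_le_ofReal ?_
    rw [norm_div, Real.norm_of_nonneg (Real.rpow_nonneg dist_nonneg δ), ← mul_div_assoc]
    exact div_le_div_of_nonneg_right (hf.dist_le_mul x y) (Real.rpow_nonneg dist_nonneg δ)

/-- The image of a Lipschitz function is bounded and measurable, hence square integrable. -/
theorem IsAhlforsRegular.memLp {δ : ℝ} {μ : Measure X} [IsFiniteMeasure μ]
    (h : IsAhlforsRegular δ μ) {f : X → ℝ} {K : ℝ≥0} (hf : LipschitzWith K f) :
    MemLp (logIntegral δ μ f) 2 μ := by
  obtain ⟨M, hM⟩ := h.exists_lintegral_le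
  refine MemLp.of_bound (C := K * M) ?_ (ae_of_all _ fun x => ?_)
  · refine StronglyMeasurable.aestronglyMeasurable ?_
    refine StronglyMeasurable.integral_prod_right' (f := fun p : X × X =>
      (f p.1 - f p.2) / dist p.1 p.2 ^ δ) (Measurable.stronglyMeasurable ?_)
    exact ((hf.continuous.comp continuous_fst).sub
      (hf.continuous.comp continuous_snd)).measurable.div (continuous_dist.measurable.pow_const δ)
  · refine (norm_integral_le_lintegral_norm _).trans ?_
    refine ENNReal.toReal_le_of_le_ofReal (by positivity) ?_
    rw [ENNReal.ofReal_mul K.coe_nonneg, ENNReal.ofReal_coe_nnreal, ENNReal.ofReal_coe_nnreal]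
    refine le_trans ?_ (mul_le_mul_right (hM x) _)
    rw [← lintegral_const_mul' _ _ ENNReal.coe_ne_top]
    refine lintegral_mono fun y => ?_
    rw [← ENNReal.ofReal_coe_nnreal, ← ENNReal.ofReal_mul K.coe_nonneg]
    refine ENNReal.ofReal_le_ofReal ?_
    rw [norm_div, Real.norm_of_nonneg (Real.rpow_nonneg dist_nonneg δ), ← mul_div_assoc]
    exact div_le_div_of_nonneg_right (hf.dist_le_mul x y) (Real.rpow_nonneg dist_nonneg δ)

theorem IsAhlforsRegular.memLp_coe {δ : ℝ} {μ : Measure X} [IsFiniteMeasure μ]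
    (h : IsAhlforsRegular δ μ) (u : lipSubmodule μ) :
    MemLp (logIntegral δ μ (u : Lp ℝ 2 μ)) 2 μ := by
  obtain ⟨f, K, hf, hu⟩ := u.2
  exact (h.memLp hf).ae_eq (logIntegral_congr_ae hu).symm

/-- The operator `Δ₀ f (x) = ∫ (f x - f y) / d(x, y) ^ δ dμ(y)` in the real Hilbert space
`L²(X, μ)`, with the Lipschitz functions as its domain. -/
def logLaplacianLip {δ : ℝ} {μ : Measure X} [IsFiniteMeasure μ] (h : IsAhlforsRegular δ μ) :
    Lp ℝ 2 μ →ₗ.[ℝ] Lp ℝ 2 μ where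
  domain := lipSubmodule μ
  toFun :=
    { toFun := fun u => (h.memLp_coe u).toLp (logIntegral δ μ (u : Lp ℝ 2 μ))
      map_add' := by
        rintro ⟨u, f, K, hf, hu⟩ ⟨v, g, L, hg, hv⟩
        rw [← MemLp.toLp_add, MemLp.toLp_eq_toLp_iff]
        refine (logIntegral_congr_ae ((Lp.coeFn_add u v).trans (hu.add hv))).trans
          (EventuallyEq.trans ?_ ((logIntegral_congr_ae hu).add (logIntegral_congr_ae hv)).symm)
        refine ae_of_all _ fun x => ?_
        simp only [logIntegral, Pi.add_apply]
        rw [← integral_add (h.integrable hf x) (h.integrable hg x)]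
        congr 1 with y
        ring
      map_smul' := by
        rintro c ⟨u, f, K, hf, hu⟩
        rw [RingHom.id_apply, ← MemLp.toLp_const_smul, MemLp.toLp_eq_toLp_iff]
        refine (logIntegral_congr_ae ((Lp.coeFn_smul c u).trans (hu.const_smul c))).trans
          (EventuallyEq.trans ?_ ((logIntegral_congr_ae hu).const_smul c).symm)
        refine ae_of_all _ fun x => ?_
        simp only [logIntegral, Pi.smul_apply, smul_eq_mul]
        rw [← integral_const_mul]
        congr 1 with y
        ring }

/-- On the class of a Lipschitz function `f`, the operator is given by the integral formula. -/
theorem logLaplacianLip_apply {δ : ℝ} {μ : Measure X} [IsFiniteMeasure μ]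
    (h : IsAhlforsRegular δ μ) (u : (logLaplacianLip h).domain) {f : X → ℝ}
    (hu : (u : Lp ℝ 2 μ) =ᵐ[μ] f) :
    logLaplacianLip h u =ᵐ[μ] fun x => ∫ y, (f x - f y) / dist x y ^ δ ∂μ :=
  (MemLp.coeFn_toLp (h.memLp_coe u)).trans (logIntegral_congr_ae hu)

end LogLaplacian

end

/-! The operator is built from a bi-invariant distance and Haar measure, so it commutes with right
translations. Averaging against a left-invariant kernel, `∫ k x y * f y`, is a superposition of
right translates `∫ k 1 g * f (x * g)`, so such averages commute with it as well. Tent functions of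
the distance give symmetric Lipschitz kernels of mass one that shrink to the diagonal; the resulting
operators `P n` are symmetric, map all of L² into the Lipschitz functions and tend strongly to the
identity.

This suffices for essential self-adjointness: if `(x, y)` lies in the graph of the adjoint of `T`,
then `T (P n x) = P n y`, so `(x, y)` is the limit of the points `(P n x, P n y)` of the graph of
`T`. Hence the adjoint is the closure. Symmetry of the operator itself comes from Fubini, with
Ahlfors regularity making the double integrals absolutely convergent. -/

/-! ### A criterion for essential self-adjointness -/

/-- A densely defined symmetric operator is essentially self-adjoint as soon as there are symmetric
everywhere defined operators that converge strongly to the identity, map the space into the domain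
and commute with the operator. -/
theorem LinearPMap.IsFormalAdjoint.isEssentiallySelfAdjoint {H : Type*} [NormedAddCommGroup H]
    [InnerProductSpace ℝ H] [CompleteSpace H] {T : H →ₗ.[ℝ] H} (hT : T.IsFormalAdjoint T)
    {P : ℕ → H →ₗ[ℝ] H} (hP : ∀ n, (P n).IsSymmetric)
    (hlim : ∀ u, Tendsto (fun n => P n u) atTop (𝓝 u)) (hdom : ∀ n u, P n u ∈ T.domain)
    (hcomm : ∀ n (w : T.domain), T ⟨P n w, hdom n w⟩ = P n (T w)) :
    T.IsEssentiallySelfAdjoint := by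
  have hd : Dense (T.domain : Set H) := fun u =>
    mem_closure_of_tendsto (hlim u) (Eventually.of_forall fun n => hdom n u)
  have hcl : T.IsClosable :=
    LinearPMap.IsClosable.leIsClosable (T.adjoint_isClosed hd).isClosable (hT.le_adjoint hd)
  -- The right-hand side describes the graph of the adjoint of `T`. One inclusion is symmetry plus
  -- continuity; the other is regularisation by `P n`.
  have hadj : ∀ x y : H, (x, y) ∈ T.closure.graph ↔ ∀ w : T.domain,
      inner ℝ y (w : H) = inner ℝ x (T w) := by
    intro x y
    rw [← hcl.graph_closure_eq_closure_graph, ← SetLike.mem_coe, Submodule.topologicalClosure_coe]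
    constructor
    · intro hxy w
      have hcs : _root_.IsClosed {p : H × H | inner ℝ p.2 (w : H) = inner ℝ p.1 (T w)} :=
        isClosed_eq (by fun_prop) (by fun_prop)
      refine closure_minimal (t := {p : H × H | inner ℝ p.2 (w : H) = inner ℝ p.1 (T w)}) ?_ hcs hxy
      rintro ⟨a, b⟩ hab
      obtain ⟨a', ha, hb⟩ := (LinearPMap.mem_graph_iff T).1 hab
      dsimp only at ha hb
      subst ha hb
      exact hT a' w
    · intro h
      refine mem_closure_of_tendsto ((hlim x).prodMk_nhds (hlim y))
        (Eventually.of_forall fun n => ?_)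
      refine (LinearPMap.mem_graph_iff T).2 ⟨⟨P n x, hdom n x⟩, rfl, ?_⟩
      -- Tested against `w` in the domain: ⟨T Pₙx, w⟩ = ⟨Pₙx, Tw⟩ = ⟨x, Pₙ Tw⟩ = ⟨x, T Pₙw⟩ = ⟨y,
      -- Pₙw⟩ = ⟨Pₙy, w⟩.
      refine hd.eq_of_inner_left ℝ fun w hw => ?_
      have h1 := hT ⟨P n x, hdom n x⟩ ⟨w, hw⟩
      have h2 := h ⟨P n w, hdom n w⟩
      have h3 := hcomm n ⟨w, hw⟩
      dsimp only at h1 h2 h3 ⊢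
      rw [h1, hP n x, ← h3, ← h2, ← hP n y]
  refine ⟨hd, hT, LinearPMap.isSelfAdjoint_def.2 (LinearPMap.eq_of_eq_graph ?_)⟩
  have hdc : Dense (T.closure.domain : Set H) := hd.mono T.le_closure.1
  rw [LinearPMap.adjoint_graph_eq_graph_adjoint hdc]
  ext ⟨x, y⟩
  rw [Submodule.mem_adjoint_iff, hadj]
  simp only [sub_eq_zero]
  constructor
  · intro h w
    rw [real_inner_comm, ← h w (T w) (LinearPMap.le_graph_of_le T.le_closure (T.mem_graph w)),
      real_inner_comm]
  · intro h a b hab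
    rw [← hcl.graph_closure_eq_closure_graph, ← SetLike.mem_coe,
      Submodule.topologicalClosure_coe] at hab
    have hcs : _root_.IsClosed {p : H × H | inner ℝ p.2 x = inner ℝ p.1 y} :=
      isClosed_eq (by fun_prop) (by fun_prop)
    refine closure_minimal (t := {p : H × H | inner ℝ p.2 x = inner ℝ p.1 y}) ?_ hcs hab
    rintro ⟨a, b⟩ hab
    obtain ⟨a', ha, hb⟩ := (LinearPMap.mem_graph_iff T).1 hab
    dsimp only at ha hb
    subst ha hb
    simpa only [mem_ofPred_eq, real_inner_comm] using (h a').symm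

/-! ### Unimodularity of compact groups -/

/-- A Haar measure on a compact group is right-invariant. -/
theorem MeasureTheory.Measure.IsHaarMeasure.isMulRightInvariant_of_compactSpace {G : Type*}
    [Group G] [TopologicalSpace G] [IsTopologicalGroup G] [CompactSpace G] [MeasurableSpace G]
    [BorelSpace G] (ν : Measure G) [ν.IsHaarMeasure] : ν.IsMulRightInvariant := by
  refine ⟨fun g => ?_⟩
  -- A right translate of `ν` is still left-invariant, hence a multiple of `ν`; comparing the finite
  -- nonzero total masses forces the factor to be 1.
  have h := Measure.isMulInvariant_eq_smul_of_compactSpace (ν.map (· * g)) ν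
  have h1 := congrArg (fun m : Measure G => m univ) h
  simp only [Measure.smul_apply] at h1
  rw [Measure.map_apply (measurable_mul_const g) MeasurableSet.univ, preimage_univ,
    ENNReal.smul_def, smul_eq_mul] at h1
  have hc : (Measure.haarScalarFactor (ν.map (· * g)) ν : ℝ≥0∞) = 1 :=
    (ENNReal.mul_right_inj (IsOpenPosMeasure.open_pos _ isOpen_univ univ_nonempty)
      (measure_ne_top ν univ)).1 (by rw [mul_one, mul_comm]; exact h1.symm)
  rw [h, ENNReal.coe_eq_one.1 hc, one_smul]

/-! ### Averaging operators on L² -/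

theorem MeasureTheory.Lp.integrable_of_two {X : Type*} [MeasurableSpace X] {μ : Measure X}
    [IsFiniteMeasure μ] (u : Lp ℝ 2 μ) : Integrable u μ :=
  (Lp.memLp u).integrable one_le_two

/-- A symmetric Markov kernel density that is Lipschitz, uniformly in the other variable. -/
structure IsAveragingKernel {X : Type*} [MetricSpace X] [MeasurableSpace X] (μ : Measure X)
    (k : X → X → ℝ) : Prop where
  symm : ∀ x y, k x y = k y x
  nonneg : ∀ x y, 0 ≤ k x y
  integral_eq_one : ∀ x, ∫ y, k x y ∂μ = 1
  lipschitz : ∃ L : ℝ≥0, ∀ y, LipschitzWith L fun x => k x y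

namespace IsAveragingKernel

theorem continuous_uncurry {X : Type*} [MetricSpace X] [MeasurableSpace X] {μ : Measure X}
    {k : X → X → ℝ} (hk : IsAveragingKernel μ k) :
    Continuous fun p : X × X => k p.1 p.2 := by
  obtain ⟨L, hL⟩ := hk.lipschitz
  have hL' : ∀ x, LipschitzWith L (k x) := fun x =>
    (funext fun y => hk.symm y x : (fun y => k y x) = k x) ▸ hL x
  exact (LipschitzWith.uncurry (f := k) hL hL').continuous

theorem exists_le {X : Type*} [MetricSpace X] [MeasurableSpace X] [CompactSpace X] {μ : Measure X}
    {k : X → X → ℝ} (hk : IsAveragingKernel μ k) : ∃ C, ∀ x y, |k x y| ≤ C := by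
  obtain ⟨C, hC⟩ := isCompact_univ.exists_bound_of_continuousOn hk.continuous_uncurry.continuousOn
  exact ⟨C, fun x y => hC (x, y) (mem_univ _)⟩

variable {X : Type*} [MetricSpace X] [MeasurableSpace X] [BorelSpace X] [CompactSpace X]
  {μ : Measure X} {k : X → X → ℝ}

theorem integrable_mul (hk : IsAveragingKernel μ k) {u : X → ℝ} (hu : Integrable u μ) (x : X) :
    Integrable (fun y => k x y * u y) μ := by
  obtain ⟨C, hC⟩ := hk.exists_le
  exact hu.bdd_mul (c := C) (hk.continuous_uncurry.comp
    (Continuous.prodMk_right x)).aestronglyMeasurable (ae_of_all _ fun y => hC x y)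

theorem integrable_prod_mul (hk : IsAveragingKernel μ k) {f : X × X → ℝ}
    (hf : Integrable f (μ.prod μ)) : Integrable (fun p => k p.1 p.2 * f p) (μ.prod μ) := by
  obtain ⟨C, hC⟩ := hk.exists_le
  exact hf.bdd_mul (c := C) hk.continuous_uncurry.aestronglyMeasurable
    (ae_of_all _ fun p => hC p.1 p.2)

/-- The uniform Lipschitz bound of the kernel passes under the integral. This is what brings
averages of arbitrary L² functions into the domain. -/
theorem lipschitzWith_integral (hk : IsAveragingKernel μ k) :
    ∃ L : ℝ≥0, ∀ u : X → ℝ, Integrable u μ →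
      LipschitzWith (L * (∫ y, ‖u y‖ ∂μ).toNNReal) fun x => ∫ y, k x y * u y ∂μ := by
  obtain ⟨L, hL⟩ := hk.lipschitz
  refine ⟨L, fun u hu => LipschitzWith.of_dist_le_mul fun x x' => ?_⟩
  rw [Real.dist_eq, ← integral_sub (hk.integrable_mul hu x) (hk.integrable_mul hu x'),
    NNReal.coe_mul, Real.coe_toNNReal _ (by positivity), ← Real.norm_eq_abs]
  refine (norm_integral_le_of_norm_le (hu.norm.const_mul (L * dist x x'))
    (ae_of_all _ fun y => ?_)).trans_eq ?_
  · rw [← sub_mul, norm_mul]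
    exact mul_le_mul_of_nonneg_right ((hL y).dist_le_mul x x') (norm_nonneg _)
  · rw [integral_const_mul]
    ring

variable [IsFiniteMeasure μ]

theorem integrable_kernel (hk : IsAveragingKernel μ k) (x : X) : Integrable (k x) μ := by
  simpa using hk.integrable_mul (integrable_const (1 : ℝ)) x

theorem memLp_integral (hk : IsAveragingKernel μ k) {u : X → ℝ} (hu : Integrable u μ) :
    MemLp (fun x => ∫ y, k x y * u y ∂μ) 2 μ := by
  obtain ⟨L, hL⟩ := hk.lipschitzWith_integral
  obtain ⟨C, hC⟩ := isCompact_univ.exists_bound_of_continuousOn (hL u hu).continuous.continuousOn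
  exact MemLp.of_bound (hL u hu).continuous.aestronglyMeasurable C
    (ae_of_all _ fun x => hC x (mem_univ x))

/-- The integral operator on `L²` with an averaging kernel. -/
noncomputable def op (hk : IsAveragingKernel μ k) : Lp ℝ 2 μ →ₗ[ℝ] Lp ℝ 2 μ where
  toFun u := (hk.memLp_integral (Lp.integrable_of_two u)).toLp _
  map_add' u v := by
    rw [← MemLp.toLp_add, MemLp.toLp_eq_toLp_iff]
    refine ae_of_all _ fun x => ?_
    rw [Pi.add_apply, ← integral_add (hk.integrable_mul (Lp.integrable_of_two u) x)
      (hk.integrable_mul (Lp.integrable_of_two v) x)]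
    refine integral_congr_ae ?_
    filter_upwards [Lp.coeFn_add u v] with y hy
    rw [hy, Pi.add_apply, mul_add]
  map_smul' c u := by
    rw [RingHom.id_apply, ← MemLp.toLp_const_smul, MemLp.toLp_eq_toLp_iff]
    refine ae_of_all _ fun x => ?_
    rw [Pi.smul_apply, smul_eq_mul, ← integral_const_mul]
    refine integral_congr_ae ?_
    filter_upwards [Lp.coeFn_smul c u] with y hy
    rw [hy, Pi.smul_apply, smul_eq_mul]
    ring

theorem op_apply (hk : IsAveragingKernel μ k) {u : Lp ℝ 2 μ} {f : X → ℝ} (hu : u =ᵐ[μ] f) :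
    hk.op u =ᵐ[μ] fun x => ∫ y, k x y * f y ∂μ := by
  refine (MemLp.coeFn_toLp (hk.memLp_integral (Lp.integrable_of_two u))).trans
    (ae_of_all _ fun x => ?_)
  refine integral_congr_ae ?_
  filter_upwards [hu] with y hy
  rw [hy]

theorem op_mem_lipSubmodule (hk : IsAveragingKernel μ k) (u : Lp ℝ 2 μ) :
    hk.op u ∈ lipSubmodule μ := by
  obtain ⟨L, hL⟩ := hk.lipschitzWith_integral
  exact ⟨_, _, hL u (Lp.integrable_of_two u), hk.op_apply EventuallyEq.rfl⟩

theorem op_isSymmetric (hk : IsAveragingKernel μ k) : hk.op.IsSymmetric := by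
  intro u w
  have hu := Lp.integrable_of_two u
  have hw := Lp.integrable_of_two w
  have hi := hk.integrable_prod_mul (hu.mul_prod hw)
  calc inner ℝ (hk.op u) w = ∫ y, ∫ x, k x y * (u x * w y) ∂μ ∂μ := by
        rw [L2.inner_def]
        refine integral_congr_ae ?_
        filter_upwards [hk.op_apply (u := u) EventuallyEq.rfl] with y hy
        rw [hy, Real.inner_apply, ← integral_mul_const]
        simp only [hk.symm y, mul_assoc]
    _ = ∫ x, ∫ y, k x y * (u x * w y) ∂μ ∂μ := (integral_integral_swap hi).symm
    _ = inner ℝ u (hk.op w) := by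
        rw [L2.inner_def]
        refine integral_congr_ae ?_
        filter_upwards [hk.op_apply (u := w) EventuallyEq.rfl] with x hx
        rw [hx, Real.inner_apply, mul_comm, ← integral_mul_const]
        congr 1 with y
        ring

/-- Jensen's inequality for the probability density `k x`, obtained by integrating `k x y * (u y -
w) ^ 2 ≥ 0` with `w` the mean. -/
theorem sq_integral_le (hk : IsAveragingKernel μ k) {u : X → ℝ} (hu : MemLp u 2 μ) (x : X) :
    (∫ y, k x y * u y ∂μ) ^ 2 ≤ ∫ y, k x y * u y ^ 2 ∂μ := by
  set w := ∫ y, k x y * u y ∂μ with hw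
  have h1 := (hk.integrable_mul (hu.integrable one_le_two) x).const_mul (2 * w)
  have h2 := hk.integrable_mul hu.integrable_sq x
  have h3 := (hk.integrable_kernel x).const_mul (w ^ 2)
  have h : ∫ y, 2 * w * (k x y * u y) ∂μ ≤ ∫ y, (k x y * u y ^ 2 + w ^ 2 * k x y) ∂μ :=
    integral_mono h1 (h2.add h3) fun y => by
      have := mul_nonneg (hk.nonneg x y) (sq_nonneg (u y - w))
      dsimp only
      linarith
  rw [integral_const_mul, integral_add h2 h3, integral_const_mul, hk.integral_eq_one, ← hw] at h
  linarith

/-- Jensen at each point, then Fubini: by symmetry the kernel also has mass one in its first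
variable. -/
theorem norm_op_le (hk : IsAveragingKernel μ k) (u : Lp ℝ 2 μ) : ‖hk.op u‖ ≤ ‖u‖ := by
  have hu := (Lp.memLp u).integrable_sq
  have hi : Integrable (fun p : X × X => k p.1 p.2 * u p.2 ^ 2) (μ.prod μ) :=
    hk.integrable_prod_mul (f := fun p => u p.2 ^ 2) (hu.comp_snd μ)
  have hsq : ∀ v : Lp ℝ 2 μ, ‖v‖ ^ 2 = ∫ x, v x ^ 2 ∂μ := fun v => by
    rw [← real_inner_self_eq_norm_sq, L2.inner_def]
    simp only [real_inner_self_eq_norm_sq, Real.norm_eq_abs, sq_abs]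
  refine le_of_sq_le_sq ?_ (norm_nonneg u)
  rw [hsq, hsq]
  calc ∫ x, hk.op u x ^ 2 ∂μ ≤ ∫ x, ∫ y, k x y * u y ^ 2 ∂μ ∂μ := by
        refine integral_mono_ae (Lp.memLp (hk.op u)).integrable_sq hi.integral_prod_left ?_
        filter_upwards [hk.op_apply (u := u) EventuallyEq.rfl] with x hx
        rw [hx]
        exact hk.sq_integral_le (Lp.memLp u) x
    _ = ∫ y, ∫ x, k x y * u y ^ 2 ∂μ ∂μ := integral_integral_swap hi
    _ = ∫ y, u y ^ 2 ∂μ := by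
        congr 1 with y
        rw [integral_mul_const]
        simp only [fun x => hk.symm x y, hk.integral_eq_one, one_mul]

theorem abs_integral_sub_le (hk : IsAveragingKernel μ k) {f : X → ℝ} (hf : Integrable f μ) {ε : ℝ}
    (x : X) (h : ∀ y, k x y ≠ 0 → |f y - f x| ≤ ε) : |(∫ y, k x y * f y ∂μ) - f x| ≤ ε := by
  have h1 : (∫ y, k x y * f y ∂μ) - f x = ∫ y, (k x y * f y - f x * k x y) ∂μ := by
    rw [integral_sub (hk.integrable_mul hf x) ((hk.integrable_kernel x).const_mul _),
      integral_const_mul, hk.integral_eq_one, mul_one]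
  rw [h1, ← Real.norm_eq_abs]
  refine (norm_integral_le_of_norm_le ((hk.integrable_kernel x).const_mul ε)
    (ae_of_all _ fun y => ?_)).trans_eq ?_
  · rw [mul_comm (f x), ← mul_sub, norm_mul, Real.norm_of_nonneg (hk.nonneg x y), mul_comm]
    by_cases hxy : k x y = 0
    · simp [hxy]
    · exact mul_le_mul_of_nonneg_right (h y hxy) (hk.nonneg x y)
  · rw [integral_const_mul, hk.integral_eq_one, mul_one]

/-- Averaging operators whose kernels concentrate on the diagonal converge strongly to the
identity of `L²`. -/
theorem tendsto_op {k : ℕ → X → X → ℝ} (hk : ∀ n, IsAveragingKernel μ (k n))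
    (h : ∀ η > 0, ∀ᶠ n in atTop, ∀ x y, k n x y ≠ 0 → dist x y < η) (u : Lp ℝ 2 μ) :
    Tendsto (fun n => (hk n).op u) atTop (𝓝 u) := by
  rw [Metric.tendsto_nhds]
  intro ε hε
  -- Contractivity reduces the claim to a continuous `f` near `u`, which is uniformly continuous by
  -- compactness.
  obtain ⟨_, hv, f, rfl⟩ := Metric.dense_iff.1
    (ContinuousMap.toLp_denseRange ℝ μ ℝ (p := 2) (by simp)) u (ε / 3) (by positivity)
  set v := ContinuousMap.toLp 2 μ ℝ f
  have hvf : v =ᵐ[μ] f := ContinuousMap.coeFn_toLp μ f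
  set a := (measureUnivNNReal μ : ℝ) ^ (ENNReal.toReal 2)⁻¹ with ha
  have ha0 : 0 ≤ a := by positivity
  -- The factor `a` turns a uniform bound into an L² bound, so `a * c < ε / 3`; the `+ 1` keeps the
  -- denominator positive when `a = 0`.
  set c := ε / (4 * (a + 1)) with hc
  have hc0 : 0 < c := by positivity
  obtain ⟨η, hη, hfη⟩ := Metric.uniformContinuous_iff.1
    (CompactSpace.uniformContinuous_of_continuous f.continuous) c hc0
  filter_upwards [h η hη] with n hn
  have h1 : ‖(hk n).op v - v‖ ≤ a * c := by
    refine Lp.norm_le_of_ae_bound hc0.le ?_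
    filter_upwards [Lp.coeFn_sub ((hk n).op v) v, (hk n).op_apply hvf, hvf] with x h1 h2 h3
    rw [h1, Pi.sub_apply, h2, h3]
    refine (hk n).abs_integral_sub_le ((Lp.integrable_of_two v).congr hvf) x fun y hy => ?_
    rw [abs_sub_comm]
    exact (hfη (hn x y hy)).le
  have h2 : a * c < ε / 3 := by
    rw [hc, ← mul_div_assoc, div_lt_div_iff₀ (by positivity) (by positivity)]
    nlinarith
  have h3 : ‖(hk n).op (u - v)‖ ≤ ‖u - v‖ := (hk n).norm_op_le _
  rw [Metric.mem_ball, dist_comm, dist_eq_norm] at hv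
  rw [dist_eq_norm]
  calc ‖(hk n).op u - u‖ = ‖(hk n).op (u - v) + ((hk n).op v - v) - (u - v)‖ := by
        rw [map_sub]; congr 1; abel
    _ ≤ ‖(hk n).op (u - v)‖ + ‖(hk n).op v - v‖ + ‖u - v‖ :=
        (norm_sub_le _ _).trans (add_le_add_left (norm_add_le _ _) _)
    _ < ε := by linarith

end IsAveragingKernel

/-! ### Symmetry on Lipschitz functions -/

section Symmetric

variable {X : Type*} [MetricSpace X] [MeasurableSpace X] [BorelSpace X] [CompactSpace X]
  {μ : Measure X} [IsFiniteMeasure μ] {δ : ℝ}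

theorem IsAhlforsRegular.integrable_prod (h : IsAhlforsRegular δ μ) {f : X → ℝ} {K : ℝ≥0}
    (hf : LipschitzWith K f) :
    Integrable (fun p : X × X => (f p.1 - f p.2) / dist p.1 p.2 ^ δ) (μ.prod μ) := by
  obtain ⟨M, hM⟩ := h.exists_lintegral_le
  have hmeas : Measurable fun p : X × X => (f p.1 - f p.2) / dist p.1 p.2 ^ δ :=
    ((hf.continuous.comp continuous_fst).sub
      (hf.continuous.comp continuous_snd)).measurable.div (continuous_dist.measurable.pow_const δ)
  refine ⟨hmeas.aestronglyMeasurable, ?_⟩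
  refine lt_of_le_of_lt (b := ∫⁻ _, K * M ∂μ) ?_ (by
    rw [lintegral_const]
    exact ENNReal.mul_lt_top (ENNReal.mul_lt_top ENNReal.coe_lt_top ENNReal.coe_lt_top)
      (measure_lt_top μ univ))
  rw [lintegral_prod _ hmeas.enorm.aemeasurable]
  refine lintegral_mono fun x => le_trans ?_ (mul_le_mul_right (hM x) _)
  rw [← lintegral_const_mul' _ _ ENNReal.coe_ne_top]
  refine lintegral_mono fun y => ?_
  rw [← ENNReal.ofReal_coe_nnreal, ← ENNReal.ofReal_mul K.coe_nonneg, ← ofReal_norm]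
  refine ENNReal.ofReal_le_ofReal ?_
  rw [norm_div, Real.norm_of_nonneg (Real.rpow_nonneg dist_nonneg δ), ← mul_div_assoc]
  exact div_le_div_of_nonneg_right (hf.dist_le_mul x y) (Real.rpow_nonneg dist_nonneg δ)

/-- As double integrals, the two sides differ by the integral of `(f x * g y - f y * g x) / d(x, y)
^ δ`, which is antisymmetric under swapping `x` and `y` and so integrates to zero. -/
theorem IsAhlforsRegular.integral_logIntegral_mul (h : IsAhlforsRegular δ μ) {f g : X → ℝ}
    {K L : ℝ≥0} (hf : LipschitzWith K f) (hg : LipschitzWith L g) :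
    ∫ x, logIntegral δ μ f x * g x ∂μ = ∫ x, f x * logIntegral δ μ g x ∂μ := by
  obtain ⟨A, hA⟩ := isCompact_univ.exists_bound_of_continuousOn hf.continuous.continuousOn
  obtain ⟨B, hB⟩ := isCompact_univ.exists_bound_of_continuousOn hg.continuous.continuousOn
  have h1 : Integrable (fun p : X × X => g p.1 * ((f p.1 - f p.2) / dist p.1 p.2 ^ δ))
      (μ.prod μ) :=
    (h.integrable_prod hf).bdd_mul (c := B)
      (hg.continuous.comp continuous_fst).aestronglyMeasurable
      (ae_of_all _ fun p => hB p.1 (mem_univ _))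
  have h2 : Integrable (fun p : X × X => f p.1 * ((g p.1 - g p.2) / dist p.1 p.2 ^ δ))
      (μ.prod μ) :=
    (h.integrable_prod hg).bdd_mul (c := A)
      (hf.continuous.comp continuous_fst).aestronglyMeasurable
      (ae_of_all _ fun p => hA p.1 (mem_univ _))
  have e1 : ∫ x, logIntegral δ μ f x * g x ∂μ =
      ∫ p, g p.1 * ((f p.1 - f p.2) / dist p.1 p.2 ^ δ) ∂(μ.prod μ) := by
    rw [integral_prod _ h1]
    simp only [integral_const_mul, logIntegral, mul_comm]
  have e2 : ∫ x, f x * logIntegral δ μ g x ∂μ =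
      ∫ p, f p.1 * ((g p.1 - g p.2) / dist p.1 p.2 ^ δ) ∂(μ.prod μ) := by
    rw [integral_prod _ h2]
    simp only [integral_const_mul, logIntegral]
  rw [e1, e2, ← sub_eq_zero, ← integral_sub h1 h2]
  have h3 := integral_prod_swap (μ := μ) (ν := μ) fun p : X × X =>
    g p.1 * ((f p.1 - f p.2) / dist p.1 p.2 ^ δ) - f p.1 * ((g p.1 - g p.2) / dist p.1 p.2 ^ δ)
  rw [← self_eq_neg, ← integral_neg, ← h3]
  congr 1 with p
  simp only [Prod.fst_swap, Prod.snd_swap, dist_comm p.2 p.1]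
  ring

theorem logLaplacianLip_isFormalAdjoint (h : IsAhlforsRegular δ μ) :
    (logLaplacianLip h).IsFormalAdjoint (logLaplacianLip h) := by
  rintro ⟨u, f, K, hf, hu⟩ ⟨w, g, L, hg, hw⟩
  rw [L2.inner_def, L2.inner_def]
  refine Eq.trans (integral_congr_ae ?_) ((h.integral_logIntegral_mul hf hg).trans
    (integral_congr_ae ?_))
  · filter_upwards [logLaplacianLip_apply h ⟨u, f, K, hf, hu⟩ hu, hw] with x h1 h2
    rw [h1, h2, Real.inner_apply]
    rfl
  · filter_upwards [logLaplacianLip_apply h ⟨w, g, L, hg, hw⟩ hw, hu] with x h1 h2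
    rw [h1, h2, Real.inner_apply]
    rfl

end Symmetric

/-! ### Invariant kernels and commutation -/

section Group

/-- The substitution `y = x * g` exhibits the average as a superposition of right translates of `f`.
-/
theorem integral_kernel_mul_eq {G : Type*} [Group G] [MeasurableSpace G] [MeasurableMul G]
    {ν : Measure G} [ν.IsMulLeftInvariant] {k : G → G → ℝ}
    (hk : ∀ a x y, k (a * x) (a * y) = k x y) (f : G → ℝ) (x : G) :
    ∫ y, k x y * f y ∂ν = ∫ g, k 1 g * f (x * g) ∂ν := by
  rw [← integral_mul_left_eq_self _ x]
  congr 1 with g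
  rw [← hk x 1 g, mul_one]

theorem logIntegral_mul_right {G : Type*} [Group G] [MetricSpace G] [MeasurableSpace G]
    [MeasurableMul G] {ν : Measure G} {δ : ℝ} [IsIsometricSMul Gᵐᵒᵖ G] [ν.IsMulRightInvariant]
    (f : G → ℝ) (x g : G) :
    ∫ y, (f (x * g) - f (y * g)) / dist x y ^ δ ∂ν = logIntegral δ ν f (x * g) := by
  have h := integral_mul_right_eq_self (μ := ν) (fun y => (f (x * g) - f y) / dist (x * g) y ^ δ) g
  simpa only [dist_mul_right, logIntegral] using h

variable {G : Type*} [Group G] [MetricSpace G] [IsTopologicalGroup G] [CompactSpace G]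
  [MeasurableSpace G] [BorelSpace G] {ν : Measure G} {δ : ℝ}

/-- Averaging with a left-invariant kernel commutes with the operator. -/
theorem logIntegral_integral_kernel [IsIsometricSMul Gᵐᵒᵖ G] [IsFiniteMeasure ν]
    [ν.IsMulLeftInvariant] [ν.IsMulRightInvariant] (hν : IsAhlforsRegular δ ν) {k : G → G → ℝ}
    (hk : IsAveragingKernel ν k) (hinv : ∀ a x y, k (a * x) (a * y) = k x y) {f : G → ℝ}
    {K : ℝ≥0} (hf : LipschitzWith K f) (x : G) :
    logIntegral δ ν (fun x => ∫ y, k x y * f y ∂ν) x = ∫ y, k x y * logIntegral δ ν f y ∂ν := by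
  obtain ⟨C, hC⟩ := hk.exists_le
  have hC0 : 0 ≤ C := (abs_nonneg _).trans (hC 1 1)
  have hfx : ∀ z, Integrable (fun g => k 1 g * f (z * g)) ν := fun z =>
    hk.integrable_mul ((hf.continuous.comp (continuous_const_mul z)).integrable_of_hasCompactSupport
      (HasCompactSupport.of_compactSpace _)) 1
  -- By right-invariance of the distance, `|f (x * g) - f (y * g)| ≤ K * d(x, y)`, so the integrand
  -- is dominated by `C * K * d(x, y) ^ (1 - δ)`, which does not depend on `g`.
  have hi : Integrable (fun p : G × G => k 1 p.2 * ((f (x * p.2) - f (p.1 * p.2)) /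
      dist x p.1 ^ δ)) (ν.prod ν) := by
    have hd : Integrable (fun y => dist x y / dist x y ^ δ) ν := by
      refine (hν.integrable (LipschitzWith.dist_right x) x).neg.congr (ae_of_all _ fun y => ?_)
      simp [neg_div]
    refine Integrable.mono' ((hd.comp_fst ν).const_mul (C * K)) ?_ (ae_of_all _ fun p => ?_)
    · refine Measurable.aestronglyMeasurable (Measurable.mul ?_ (Measurable.div ?_ ?_))
      · have hc : Continuous fun p : G × G => ((1, p.2) : G × G) := by fun_prop
        exact (hk.continuous_uncurry.comp hc).measurable
      · exact ((hf.continuous.comp (continuous_const.mul continuous_snd)).sub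
          (hf.continuous.comp (continuous_fst.mul continuous_snd))).measurable
      · exact (continuous_const.dist continuous_fst).measurable.pow_const δ
    · rw [norm_mul, norm_div, Real.norm_of_nonneg (Real.rpow_nonneg dist_nonneg δ), mul_assoc C,
        ← mul_div_assoc (K : ℝ)]
      refine mul_le_mul (hC _ _) (div_le_div_of_nonneg_right ?_ (Real.rpow_nonneg dist_nonneg δ))
        (by positivity) hC0
      simpa only [dist_mul_right, Real.dist_eq, Real.norm_eq_abs] using
        hf.dist_le_mul (x * p.2) (p.1 * p.2)
  calc logIntegral δ ν (fun x => ∫ y, k x y * f y ∂ν) x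
      = ∫ y, ∫ g, k 1 g * ((f (x * g) - f (y * g)) / dist x y ^ δ) ∂ν ∂ν := by
        rw [logIntegral]
        congr 1 with y
        rw [integral_kernel_mul_eq hinv f x, integral_kernel_mul_eq hinv f y,
          ← integral_sub (hfx x) (hfx y), ← integral_div]
        congr 1 with g
        ring
    _ = ∫ g, ∫ y, k 1 g * ((f (x * g) - f (y * g)) / dist x y ^ δ) ∂ν ∂ν :=
        integral_integral_swap hi
    _ = ∫ g, k 1 g * logIntegral δ ν f (x * g) ∂ν := by
        simp only [integral_const_mul, logIntegral_mul_right]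
    _ = _ := (integral_kernel_mul_eq hinv _ x).symm

/-- A compact group with a bi-invariant metric carries left-invariant averaging kernels that
concentrate on the diagonal. -/
theorem exists_isAveragingKernel [IsIsometricSMul G G] (ν : Measure G) [ν.IsHaarMeasure] :
    ∃ k : ℕ → G → G → ℝ, (∀ n, IsAveragingKernel ν (k n)) ∧
      (∀ n a x y, k n (a * x) (a * y) = k n x y) ∧
      ∀ η > 0, ∀ᶠ n in atTop, ∀ x y, k n x y ≠ 0 → dist x y < η := by
  -- Tents of height 1 and radius `1 / n` (constant 1 for `n = 0`); left-invariance and symmetry are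
  -- inherited from the distance.
  set φ : ℕ → G → G → ℝ := fun n x y => max 0 (1 - n * dist x y) with hφ
  have hφinv : ∀ n a x y, φ n (a * x) (a * y) = φ n x y := fun n a x y => by
    simp only [hφ, dist_mul_left]
  have hφL : ∀ n : ℕ, ∀ y, LipschitzWith n fun x => φ n x y := fun n y => by
    refine LipschitzWith.const_max (LipschitzWith.of_dist_le_mul fun x x' => ?_) 0
    rw [Real.dist_eq, show 1 - n * dist x y - (1 - n * dist x' y) =
      n * (dist x' y - dist x y) by ring, abs_mul, Nat.abs_cast, NNReal.coe_natCast]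
    refine mul_le_mul_of_nonneg_left ?_ (Nat.cast_nonneg n)
    rw [dist_comm x x']
    exact abs_dist_sub_le _ _ _
  set c : ℕ → ℝ := fun n => ∫ y, φ n 1 y ∂ν with hc
  have hcpos : ∀ n, 0 < c n := fun n => by
    have hcont : Continuous (φ n 1) := by fun_prop
    exact hcont.integral_pos_of_hasCompactSupport_nonneg_nonzero
      (HasCompactSupport.of_compactSpace _) (fun y => le_max_left _ _) (x := 1) (by simp [hφ])
  refine ⟨fun n x y => (c n)⁻¹ * φ n x y, fun n => ⟨fun x y => ?_, fun x y => ?_, fun x => ?_, ?_⟩,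
    fun n a x y => congrArg _ (hφinv n a x y), fun η hη => ?_⟩
  · simp only [hφ, dist_comm]
  · exact mul_nonneg (inv_nonneg.2 (hcpos n).le) (le_max_left _ _)
  · rw [integral_const_mul]
    -- Taking `f = 1` shows that the mass of `φ n x` is independent of `x`, so normalising at the
    -- identity is enough.
    have := integral_kernel_mul_eq (ν := ν) (hφinv n) 1 x
    simp only [Pi.one_apply, mul_one] at this
    rw [this]
    exact inv_mul_cancel₀ (hcpos n).ne'
  · exact ⟨_, fun y => (lipschitzWith_smul (c n)⁻¹).comp (hφL n y)⟩
  · obtain ⟨N, hN⟩ := exists_nat_gt η⁻¹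
    filter_upwards [eventually_ge_atTop N] with n hn x y hxy
    by_contra! hη'
    refine hxy ?_
    have h1 : 1 ≤ n * dist x y := by
      have h2 : η⁻¹ ≤ n := hN.le.trans (Nat.cast_le.2 hn)
      calc (1 : ℝ) = η⁻¹ * η := (inv_mul_cancel₀ hη.ne').symm
        _ ≤ n * dist x y := mul_le_mul h2 hη' hη.le (Nat.cast_nonneg n)
    simp only [hφ]
    rw [max_eq_left (by linarith), mul_zero]

end Group

/-! ### Essential self-adjointness -/

theorem mainTheorem12 {G : Type*} [Group G] [MetricSpace G] [IsTopologicalGroup G] [CompactSpace G]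
    [IsIsometricSMul G G] [IsIsometricSMul Gᵐᵒᵖ G] [MeasurableSpace G] [BorelSpace G]
    (ν : Measure G) [ν.IsHaarMeasure] {δ : ℝ} (hν : IsAhlforsRegular δ ν) :
    (logLaplacianLip hν).IsEssentiallySelfAdjoint := by
  have := Measure.IsHaarMeasure.isMulRightInvariant_of_compactSpace ν
  obtain ⟨k, hk, hinv, hdiag⟩ := exists_isAveragingKernel ν
  refine (logLaplacianLip_isFormalAdjoint hν).isEssentiallySelfAdjoint
    (P := fun n => (hk n).op) (fun n => (hk n).op_isSymmetric)
    (IsAveragingKernel.tendsto_op hk hdiag) (fun n => (hk n).op_mem_lipSubmodule) ?_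
  rintro n ⟨w, f, K, hf, hw⟩
  refine Lp.ext ?_
  refine (logLaplacianLip_apply hν ⟨(hk n).op w, (hk n).op_mem_lipSubmodule w⟩
    ((hk n).op_apply hw)).trans (EventuallyEq.trans (ae_of_all _ fun x => ?_)
    ((hk n).op_apply (logLaplacianLip_apply hν ⟨w, f, K, hf, hw⟩ hw)).symm)
  exact logIntegral_integral_kernel hν (hk n) (hinv n) hf x
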